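/- Let $E_1,\dots,E_n$ be disjoint finite sets of divisible goods ($E_i$ being the goods of player $i$), let $E=E_1\cup\dots\cup E_n$, and let $f:2^E\to\mathbb R$ be monotone and submodular with $f(\emptyset)=0$. An allocation $x=(x_t)_{t\in E}\in\mathbb R_+^E$ is feasible if $\sum_{t\in S}x_t\le f(S)$ for every $S\subseteq E$; player $i$ receives $x_i=(x_t)_{t\in E_i}$. The polymatroid mechanism with capacities asks each player $i$ for a bid $b_t\ge 0$ per unit and a capacity $q_t\ge 0$ for each $t\in E_i$; these form the action $a_i$. It starts from $x=0$ and considers the goods one by one in decreasing order of the bids $b_t$ (ties are broken by an arbitrary fixed rule, which may depend on the action profile). When $t$ is considered, $x_t$ is increased until some constraint $\sum_{s\in S}x_s\le f(S)$ with $t\in S$ becomes tight or $x_t$ reaches $q_t$. For the resulting allocation $x(a)$, player $i$ pays $P_i(a)=\sum_{t\in E_i}b_t\,x_t(a)$, the utility of player $i$ is $U_i(a;v_i)=v_i(x_i(a))-P_i(a)$, and the revenue is $\mathcal R(a)=\sum_i P_i(a)$. For a randomized action of a player, $U_i$ denotes the expected utility. The valuation $v_i:\mathbb R_+^{E_i}\to\mathbb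 R_+$ of each player is monotone submodular with diminishing marginal returns: it is nondecreasing, $v_i(x\vee y)+v_i(x\wedge y)\le v_i(x)+v_i(y)$ for all $x,y\in\mathbb R_+^{E_i}$ (coordinatewise maximum and minimum), and $v_i$ is concave in each single coordinate. Then the mechanism is $(\tfrac13,1)$-smooth for these valuations: for every profile $v=(v_1,\dots,v_n)$ of such valuations that has an optimal allocation, that is, a feasible $x^*$ maximizing $\sum_i v_i(x_i)$ over all feasible $x$, with $\mathrm{Opt}(v)=\sum_i v_i(x^*_i)$, there are randomized actions $\mathbf a_i^*(v)$, one for each player $i$, such that for every action profile $a$ $$\sum_{i=1}^n U_i\bigl(\mathbf a_i^*(v),a_{-i};v_i\bigr)\ \ge\ \tfrac13\,\mathrm{Opt}(v)-\mathcal R(a).$$ -/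

import Mathlib

open scoped NNReal

/-! ## Mechanisms with quasi-linear utilities and smoothness -/

/-- A (deterministic) mechanism for the players `ι`, where player `i` receives an element of `X i`:
a set of feasible allocation vectors, the actions of each player, and the feasible allocation and
the nonnegative payments chosen at each action profile. -/
structure Mechanism (ι : Type*) (X : ι → Type*) where
  feasible : Set (∀ i, X i)
  Action : ι → Type*
  allocation : (∀ i, Action i) → ∀ i, X i
  allocation_mem : ∀ a, allocation a ∈ feasible
  payment : (∀ i, Action i) → ι → ℝ≥0

/-- The expectation of `g` under the (discrete) distribution `d`; it is only used together with
the requirement that the series converges absolutely. -/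
noncomputable def expectation {α : Type*} (d : PMF α) (g : α → ℝ) : ℝ :=
  ∑' a, (d a).toReal * g a

namespace Mechanism

variable {ι : Type*} {X : ι → Type*}

/-- The quasi-linear utility of player `i` with valuation `w` at the action profile `a`. -/
def utility (M : Mechanism ι X) (a : ∀ i, M.Action i) (i : ι) (w : X i → ℝ≥0) : ℝ :=
  (w (M.allocation a i) : ℝ) - (M.payment a i : ℝ)

/-- The revenue of the mechanism at the action profile `a`. -/
def revenue [Fintype ι] (M : Mechanism ι X) (a : ∀ i, M.Action i) : ℝ :=
  ∑ i, (M.payment a i : ℝ)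

/-- The social welfare of an allocation vector. -/
def welfare [Fintype ι] (v : ∀ i, X i → ℝ≥0) (x : ∀ i, X i) : ℝ :=
  ∑ i, (v i (x i) : ℝ)

/-- `x` is an optimal allocation: it maximizes welfare over all feasible allocations. -/
def IsOptimal [Fintype ι] (M : Mechanism ι X) (v : ∀ i, X i → ℝ≥0) (x : ∀ i, X i) : Prop :=
  x ∈ M.feasible ∧ IsMaxOn (welfare v) M.feasible x

/-- `(l, m)`-smoothness for the classes of valuations `V i`: for every valuation profile `v` in the
class, with optimal allocation `x` (so that the optimal welfare is `welfare v x`), there are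
randomized actions `d i` of the players such that at every action profile `a`, the sum over the
players `i` of the expected utility of `i` when only `i` deviates from `a`, to `d i`, is at least
`l` times the optimal welfare minus `m` times the revenue at `a`. -/
def IsSmooth [Fintype ι] [DecidableEq ι] (M : Mechanism ι X) (V : ∀ i, Set (X i → ℝ≥0))
    (l m : ℝ) : Prop :=
  0 ≤ l ∧ 0 ≤ m ∧
    ∀ v : ∀ i, X i → ℝ≥0, (∀ i, v i ∈ V i) →
      ∀ x : ∀ i, X i, M.IsOptimal v x →
        ∃ d : ∀ i, PMF (M.Action i), ∀ a : ∀ i, M.Action i,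
          (∀ i, Summable fun c : M.Action i =>
            (d i c).toReal * M.utility (Function.update a i c) i (v i)) ∧
          l * welfare v x - m * M.revenue a ≤
            ∑ i, expectation (d i) fun c => M.utility (Function.update a i c) i (v i)

end Mechanism

/-! ## Valuations -/

/-- The monotone submodular valuations `v : ℝ₊^T → ℝ₊` of bundles of divisible goods `T`:
nondecreasing, submodular on the lattice `ℝ₊^T` with the coordinatewise order, and with diminishing
marginal returns in the quantity of each single good. -/
def submodularValuations (T : Type*) [DecidableEq T] : Set ((T → ℝ≥0) → ℝ≥0) :=
  {v | Monotone v ∧ (∀ x y, v (x ⊔ y) + v (x ⊓ y) ≤ v x + v y) ∧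
    ∀ x t, ConcaveOn ℝ≥0 Set.univ fun s : ℝ≥0 => v (Function.update x t s)}

/-! ## Polymatroids and the greedy algorithm -/

/-- `f` is a monotone submodular set function with `f ∅ = 0`. -/
structure IsPolymatroidRank {G : Type*} [DecidableEq G] (f : Finset G → ℝ) : Prop where
  empty : f ∅ = 0
  mono : Monotone f
  submodular : ∀ S T, f (S ∪ T) + f (S ∩ T) ≤ f S + f T

section Greedy

variable {G : Type*} [Fintype G] [DecidableEq G]

/-- The polymatroid of `f`: the nonnegative vectors satisfying all polymatroid constraints. -/
def polymatroid (f : Finset G → ℝ) : Set (G → ℝ≥0) :=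
  {x | ∀ S : Finset G, ∑ t ∈ S, (x t : ℝ) ≤ f S}

/-- By how much the coordinate `t` of `x` can be increased until some polymatroid constraint
becomes tight. -/
noncomputable def slack (f : Finset G → ℝ) (x : G → ℝ≥0) (t : G) : ℝ :=
  (Finset.univ.filter fun S : Finset G => t ∈ S).inf'
    (show Finset.Nonempty _ from ⟨{t}, by simp⟩) fun S => f S - ∑ u ∈ S, (x u : ℝ)

/-- One iteration of the greedy algorithm, for a good `t` that has not been considered before:
increase `x t` from zero until some polymatroid constraint becomes tight or the capacity `q t`
is reached. -/
noncomputable def greedyStep (f : Finset G → ℝ) (q : G → ℝ≥0) (x : G → ℝ≥0) (t : G) : G → ℝ≥0 :=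
  Function.update x t (min (q t) (slack f x t).toNNReal)

/-- The greedy algorithm with capacities `q` that considers the goods in the order of a list. -/
noncomputable def greedy (f : Finset G → ℝ) (q : G → ℝ≥0) (goods : List G) : G → ℝ≥0 :=
  goods.foldl (greedyStep f q) 0

theorem greedyStep_mem {f : Finset G → ℝ} (q x : G → ℝ≥0) (t : G) (hx : x ∈ polymatroid f) :
    greedyStep f q x t ∈ polymatroid f := by
  intro S
  by_cases ht : t ∈ S
  · have h0 : 0 ≤ slack f x t := by
      refine Finset.le_inf' _ _ fun U _ => ?_
      have := hx U
      linarith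
    have h1 : slack f x t ≤ f S - ∑ u ∈ S, (x u : ℝ) :=
      Finset.inf'_le _ (by simpa using ht)
    have h2 : ((min (q t) (slack f x t).toNNReal : ℝ≥0) : ℝ) ≤ slack f x t := by
      rw [NNReal.coe_min, Real.coe_toNNReal _ h0]
      exact min_le_right _ _
    have h3 : ∑ u ∈ S.erase t, (greedyStep f q x t u : ℝ) = ∑ u ∈ S.erase t, (x u : ℝ) :=
      Finset.sum_congr rfl fun u hu => by
        simp [greedyStep, Function.update_of_ne (Finset.ne_of_mem_erase hu)]
    have h4 : (greedyStep f q x t t : ℝ) = ((min (q t) (slack f x t).toNNReal : ℝ≥0) : ℝ) := by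
      simp [greedyStep]
    rw [← Finset.add_sum_erase S _ ht] at h1 ⊢
    rw [h3, h4]
    have h5 : (0 : ℝ) ≤ x t := (x t).2
    linarith
  · refine le_trans (le_of_eq (Finset.sum_congr rfl fun u hu => ?_)) (hx S)
    have hut : u ≠ t := fun h => ht (h ▸ hu)
    simp [greedyStep, Function.update_of_ne hut]

theorem greedy_mem {f : Finset G → ℝ} (hf : IsPolymatroidRank f) (q : G → ℝ≥0)
    (goods : List G) : greedy f q goods ∈ polymatroid f := by
  have key : ∀ (l : List G) (x : G → ℝ≥0), x ∈ polymatroid f →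
      l.foldl (greedyStep f q) x ∈ polymatroid f := by
    intro l
    induction l with
    | nil => intro x hx; exact hx
    | cons t l ih => intro x hx; exact ih _ (greedyStep_mem q x t hx)
  refine key goods 0 fun S => ?_
  have := hf.mono (Finset.empty_subset S)
  rw [hf.empty] at this
  simpa using this

end Greedy

/-! ## The polymatroid mechanism with capacities -/

section Polymatroid

variable {ι : Type*} (E : ι → Type*)

/-- An action of a player in the mechanism with capacities: a bid per unit (first component) and a
capacity (second component) for each of the goods of the player. -/
abbrev BidCap (T : Type*) := T → ℝ≥0 × ℝ≥0

/-- The order in which the greedy algorithm considers the goods `(i, t)`, `t ∈ E i`, at each action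
profile: every good is considered exactly once, in decreasing order of the bids. Ties may be broken
in any way. -/
structure GreedyOrder where
  order : (∀ i, BidCap (E i)) → List (Σ i, E i)
  nodup : ∀ a, (order a).Nodup
  mem : ∀ a t, t ∈ order a
  sorted : ∀ a, (order a).Pairwise fun s t => (a t.1 t.2).1 ≤ (a s.1 s.2).1

variable {E} [Fintype ι] [DecidableEq ι] [∀ i, Fintype (E i)] [∀ i, DecidableEq (E i)]

/-- The allocation of the goods computed by the greedy algorithm at the action profile `a`. -/
noncomputable def greedyAllocation (f : Finset (Σ i, E i) → ℝ) (o : GreedyOrder E)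
    (a : ∀ i, BidCap (E i)) : (Σ i, E i) → ℝ≥0 :=
  greedy f (fun t => (a t.1 t.2).2) (o.order a)

/-- The polymatroid mechanism with capacities: player `i` reports a bid and a capacity for each good
in `E i`, the allocation is computed by the greedy algorithm, and every player pays the bid for each
unit allocated to the player. -/
noncomputable def polymatroidMechanism (f : Finset (Σ i, E i) → ℝ) (hf : IsPolymatroidRank f)
    (o : GreedyOrder E) : Mechanism ι fun i => E i → ℝ≥0 where
  feasible := {x | (fun t : Σ i, E i => x t.1 t.2) ∈ polymatroid f}
  Action := fun i => BidCap (E i)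
  allocation := fun a i t => greedyAllocation f o a ⟨i, t⟩
  allocation_mem := fun _ => greedy_mem hf _ _
  payment := fun a i => ∑ t, (a i t).1 * greedyAllocation f o a ⟨i, t⟩

end Polymatroid

/-!
The mechanism is even `(1/2, 1)`-smooth, and the deviations may be taken deterministic: a player
with valuation `v` who receives the bundle `x` in the optimal allocation finds linear prices `w` for
the goods that support `v` below `x` (`exists_supporting_prices`), bids `w / 2`, and asks for at
most `x`. As the deviator never receives more than `x`, the utility is at least `w / 2` per unit
received.

It remains to bound these units from below. For a threshold `θ`, the goods with bids above `θ` are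
the first ones in the greedy order, so in total they receive the whole rank of their capacities in
the polymatroid (`vectorRank_le_sum_greedy`). Hence on goods with bids above `θ`, the deviator
receives at least the increment of the rank caused by the demand of the deviator over the capacities
of the others. By diminishing returns of the rank (`vectorRank_add_add_le`), these increments add
up over the players to at least the part of the optimal allocation with `w / 2` above `θ`, minus
the amount allocated at the original profile to bids above `θ` (`layer_le_sum_deviation`).
Integrating over `θ` turns the latter amount into the revenue.
-/

/-! ### The rank of a vector in a polymatroid -/

section VectorRank

variable {G : Type*} [Fintype G] [DecidableEq G] {f : Finset G → ℝ}

/-- The rank of the vector `c` in the polymatroid of `f`, given by the min-max formula for the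
largest total of a vector of the polymatroid below `c`. -/
noncomputable def vectorRank (f : Finset G → ℝ) (c : G → ℝ) : ℝ :=
  Finset.univ.inf' Finset.univ_nonempty fun T : Finset G => f T + ∑ u ∈ Tᶜ, c u

theorem vectorRank_le (f : Finset G → ℝ) (c : G → ℝ) (T : Finset G) :
    vectorRank f c ≤ f T + ∑ u ∈ Tᶜ, c u :=
  Finset.inf'_le _ (Finset.mem_univ T)

theorem exists_vectorRank_eq (f : Finset G → ℝ) (c : G → ℝ) :
    ∃ T : Finset G, vectorRank f c = f T + ∑ u ∈ Tᶜ, c u := by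
  obtain ⟨T, -, hT⟩ := Finset.exists_mem_eq_inf' (Finset.univ_nonempty (α := Finset G))
    fun T : Finset G => f T + ∑ u ∈ Tᶜ, c u
  exact ⟨T, hT⟩

theorem sum_le_vectorRank {y c : G → ℝ} (hy : ∀ S, ∑ u ∈ S, y u ≤ f S) (hc : ∀ u, y u ≤ c u) :
    ∑ u, y u ≤ vectorRank f c := by
  obtain ⟨T, hT⟩ := exists_vectorRank_eq f c
  rw [hT, ← Finset.sum_add_sum_compl T]
  exact add_le_add (hy T) (Finset.sum_le_sum fun u _ => hc u)

/-- Diminishing returns of the vector rank: uncrossing the two minimizers on the right-hand side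
gives candidates for the left-hand side. -/
theorem vectorRank_add_add_le (hf : IsPolymatroidRank f) {c d e : G → ℝ} (hd : ∀ u, 0 ≤ d u)
    (he : ∀ u, 0 ≤ e u) :
    vectorRank f (c + d + e) + vectorRank f c ≤ vectorRank f (c + d) + vectorRank f (c + e) := by
  obtain ⟨S, hS⟩ := exists_vectorRank_eq f (c + d)
  obtain ⟨T, hT⟩ := exists_vectorRank_eq f (c + e)
  have h1 := vectorRank_le f (c + d + e) (S ∪ T)
  have h2 := vectorRank_le f c (S ∩ T)
  have h3 := hf.submodular S T
  have hc : ∑ u ∈ (S ∪ T)ᶜ, c u + ∑ u ∈ (S ∩ T)ᶜ, c u = ∑ u ∈ Sᶜ, c u + ∑ u ∈ Tᶜ, c u := by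
    rw [Finset.compl_union, Finset.compl_inter, add_comm]
    exact Finset.sum_union_inter
  have hd' : ∑ u ∈ (S ∪ T)ᶜ, d u ≤ ∑ u ∈ Sᶜ, d u :=
    Finset.sum_le_sum_of_subset_of_nonneg
      (Finset.compl_subset_compl.2 Finset.subset_union_left) fun u _ _ => hd u
  have he' : ∑ u ∈ (S ∪ T)ᶜ, e u ≤ ∑ u ∈ Tᶜ, e u :=
    Finset.sum_le_sum_of_subset_of_nonneg
      (Finset.compl_subset_compl.2 Finset.subset_union_right) fun u _ _ => he u
  simp only [Pi.add_apply, Finset.sum_add_distrib] at h1 hS hT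
  linarith

/-- The increments of the vector rank caused by the parts `b i` of a vector of the polymatroid, each
over a base `c i` that is at most `c`, add up to at least the total of the parts minus the rank of
`c`. -/
theorem sum_sub_vectorRank_le {ι : Type*} [Fintype ι] (hf : IsPolymatroidRank f) {c : G → ℝ}
    {ci b : ι → G → ℝ} (hc : ∀ u, 0 ≤ c u) (hci : ∀ i u, ci i u ≤ c u) (hb : ∀ i u, 0 ≤ b i u)
    (hbf : ∀ S, ∑ u ∈ S, ∑ i, b i u ≤ f S) :
    ∑ u, ∑ i, b i u - vectorRank f c ≤
      ∑ i, (vectorRank f (ci i + b i) - vectorRank f (ci i)) := by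
  classical
  have key : ∀ s : Finset ι, vectorRank f (c + ∑ i ∈ s, b i) - vectorRank f c ≤
      ∑ i ∈ s, (vectorRank f (ci i + b i) - vectorRank f (ci i)) := by
    intro s
    induction s using Finset.induction_on with
    | empty => simp
    | insert i s hi ih =>
      rw [Finset.sum_insert hi, Finset.sum_insert hi]
      have h := vectorRank_add_add_le hf (c := ci i) (d := b i)
        (e := c - ci i + ∑ j ∈ s, b j) (hb i) fun u => by
          have h1 := hci i u
          have h2 : 0 ≤ ∑ j ∈ s, b j u := Finset.sum_nonneg fun j _ => hb j u
          simp only [Pi.add_apply, Pi.sub_apply, Finset.sum_apply]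
          linarith
      have e1 : ci i + b i + (c - ci i + ∑ j ∈ s, b j) = c + (b i + ∑ j ∈ s, b j) := by abel
      have e2 : ci i + (c - ci i + ∑ j ∈ s, b j) = c + ∑ j ∈ s, b j := by abel
      rw [e1, e2] at h
      linarith
  refine le_trans (sub_le_sub_right ?_ _) (key Finset.univ)
  refine sum_le_vectorRank hbf fun u => ?_
  simpa using hc u

end VectorRank

/-! ### The greedy algorithm -/

theorem tight_union {G : Type*} [DecidableEq G] {f : Finset G → ℝ} (hf : IsPolymatroidRank f)
    {x : G → ℝ≥0} (hx : x ∈ polymatroid f) {S T : Finset G}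
    (hS : ∑ u ∈ S, (x u : ℝ) = f S) (hT : ∑ u ∈ T, (x u : ℝ) = f T) :
    ∑ u ∈ S ∪ T, (x u : ℝ) = f (S ∪ T) := by
  have h1 := hf.submodular S T
  have h2 := hx (S ∪ T)
  have h3 := hx (S ∩ T)
  have h4 := Finset.sum_union_inter (s₁ := S) (s₂ := T) (f := fun u => (x u : ℝ))
  linarith

section GreedyCertificate

variable {G : Type*} [Fintype G] [DecidableEq G] {f : Finset G → ℝ}

theorem exists_slack_eq (f : Finset G → ℝ) (x : G → ℝ≥0) (t : G) :
    ∃ S : Finset G, t ∈ S ∧ slack f x t = f S - ∑ u ∈ S, (x u : ℝ) := by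
  obtain ⟨S, hS, h⟩ := Finset.exists_mem_eq_inf'
    (show (Finset.univ.filter fun S : Finset G => t ∈ S).Nonempty from ⟨{t}, by simp⟩)
    fun S => f S - ∑ u ∈ S, (x u : ℝ)
  exact ⟨S, by simpa using hS, h⟩

theorem slack_nonneg {x : G → ℝ≥0} (hx : x ∈ polymatroid f) (t : G) : 0 ≤ slack f x t := by
  obtain ⟨S, -, h⟩ := exists_slack_eq f x t
  have := hx S
  linarith

theorem greedy_concat (f : Finset G → ℝ) (q : G → ℝ≥0) (l : List G) (t : G) :
    greedy f q (l ++ [t]) = greedyStep f q (greedy f q l) t := by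
  simp [greedy, List.foldl_append]

theorem greedy_eq_zero_of_notMem (q : G → ℝ≥0) (l : List G) {u : G} (hu : u ∉ l) :
    greedy f q l u = 0 := by
  induction l using List.reverseRecOn with
  | nil => rfl
  | append_singleton l t ih =>
    simp only [List.mem_append, List.mem_singleton, not_or] at hu
    rw [greedy_concat, greedyStep, Function.update_of_ne hu.2, ih hu.1]

theorem greedy_le_capacity (q : G → ℝ≥0) (l : List G) (u : G) : greedy f q l u ≤ q u := by
  induction l using List.reverseRecOn with
  | nil => exact zero_le
  | append_singleton l t ih =>
    rw [greedy_concat, greedyStep]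
    by_cases h : u = t
    · subst h; simp
    · rwa [Function.update_of_ne h]

/-- A good that the greedy algorithm does not fill up to its capacity lies in a tight set of goods
that are considered no later. -/
theorem greedy_eq_capacity_or_tight (hf : IsPolymatroidRank f) (q : G → ℝ≥0) {R : G → G → Prop}
    (hR : ∀ u, R u u) {l : List G} (hl : l.Nodup) (hs : l.Pairwise R) {u : G} (hu : u ∈ l) :
    greedy f q l u = q u ∨ ∃ S : Finset G, u ∈ S ∧ (∀ s ∈ S, s ∈ l ∧ R s u) ∧
      ∑ s ∈ S, (greedy f q l s : ℝ) = f S := by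
  induction l using List.reverseRecOn with
  | nil => simp at hu
  | append_singleton l t ih =>
    rw [List.nodup_append] at hl
    rw [List.pairwise_append] at hs
    have htl : t ∉ l := fun h => hl.2.2 t h t (by simp) rfl
    rw [greedy_concat]
    rcases eq_or_ne u t with rfl | hut
    · have h0 := slack_nonneg (greedy_mem hf q l) u
      rcases le_total (q u) (slack f (greedy f q l) u).toNNReal with h | h
      · left
        simp [greedyStep, h]
      · right
        obtain ⟨S, huS, hS⟩ := exists_slack_eq f (greedy f q l) u
        have hout : ∀ s, s ∉ l ++ [u] → greedyStep f q (greedy f q l) u s = 0 := fun s hs' => by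
          rw [← greedy_concat]; exact greedy_eq_zero_of_notMem q _ hs'
        -- Goods that are not yet considered carry nothing, so monotonicity of `f` allows to drop
        -- them from the tight set.
        have hsum : ∑ s ∈ S.filter (· ∈ l ++ [u]), (greedyStep f q (greedy f q l) u s : ℝ) =
            ∑ s ∈ S, (greedyStep f q (greedy f q l) u s : ℝ) := by
          refine Finset.sum_subset (Finset.filter_subset _ _) fun s hs1 hs2 => ?_
          rw [hout s fun h' => hs2 (Finset.mem_filter.2 ⟨hs1, h'⟩), NNReal.coe_zero]
        have htight : ∑ s ∈ S, (greedyStep f q (greedy f q l) u s : ℝ) = f S := by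
          rw [← Finset.add_sum_erase S _ huS] at hS ⊢
          have h3 : ∑ s ∈ S.erase u, (greedyStep f q (greedy f q l) u s : ℝ) =
              ∑ s ∈ S.erase u, (greedy f q l s : ℝ) :=
            Finset.sum_congr rfl fun s hs' => by
              simp [greedyStep, Function.update_of_ne (Finset.ne_of_mem_erase hs')]
          rw [h3]
          have h4 : (greedyStep f q (greedy f q l) u u : ℝ) = slack f (greedy f q l) u := by
            simp [greedyStep, h, Real.coe_toNNReal _ h0]
          rw [h4, hS, greedy_eq_zero_of_notMem q l htl]
          simp
        refine ⟨S.filter (· ∈ l ++ [u]), by simp [huS], fun s hs' => ?_, le_antisymm ?_ ?_⟩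
        · have hm := (Finset.mem_filter.1 hs').2
          refine ⟨hm, ?_⟩
          rcases List.mem_append.1 hm with h' | h'
          · exact hs.2.2 s h' u (by simp)
          · rw [List.mem_singleton.1 h']; exact hR u
        · exact greedyStep_mem q _ u (greedy_mem hf q l) _
        · rw [hsum, htight]
          exact hf.mono (Finset.filter_subset _ _)
    · have hul : u ∈ l := by simpa [hut] using hu
      have hkeep : ∀ s ∈ l, greedyStep f q (greedy f q l) t s = greedy f q l s := fun s hs' => by
        rw [greedyStep, Function.update_of_ne]
        rintro rfl
        exact htl hs'
      rcases ih hl.1 hs.1 hul with h | ⟨S, h1, h2, h3⟩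
      · left
        rw [hkeep u hul, h]
      · right
        refine ⟨S, h1, fun s hs' => ⟨by simp [(h2 s hs').1], (h2 s hs').2⟩, ?_⟩
        rw [← h3]
        exact Finset.sum_congr rfl fun s hs' => by rw [hkeep s (h2 s hs').1]

/-- The greedy algorithm allocates to the goods `u` with `θ < p u`, which it considers first, the
whole rank of their capacities. -/
theorem vectorRank_le_sum_greedy (hf : IsPolymatroidRank f) (q : G → ℝ≥0) (p : G → ℝ)
    {l : List G} (hl : l.Nodup) (hmem : ∀ u, u ∈ l) (hs : l.Pairwise fun s t => p t ≤ p s)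
    (θ : ℝ) :
    vectorRank f (fun u => if θ < p u then (q u : ℝ) else 0) ≤
      ∑ u, if θ < p u then (greedy f q l u : ℝ) else 0 := by
  set x := greedy f q l
  have hx : x ∈ polymatroid f := greedy_mem hf q l
  have hcert := fun u => greedy_eq_capacity_or_tight hf q (R := fun s t => p t ≤ p s)
    (fun _ => le_rfl) hl hs (hmem u)
  have hex : ∀ u, ∃ S : Finset G, (x u = q u ∨ u ∈ S) ∧ (∀ s ∈ S, p u ≤ p s) ∧
      ∑ s ∈ S, (x s : ℝ) = f S := by
    intro u
    rcases hcert u with h | ⟨S, h1, h2, h3⟩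
    · exact ⟨∅, Or.inl h, by simp, by simp [hf.empty]⟩
    · exact ⟨S, Or.inr h1, fun s hs' => (h2 s hs').2, h3⟩
  choose S hS1 hS2 hS3 using hex
  set H : Finset G := Finset.univ.filter fun u => θ < p u with hH
  set T : Finset G := H.sup S
  have htight : ∑ u ∈ T, (x u : ℝ) = f T :=
    Finset.sup_induction (p := fun T : Finset G => ∑ u ∈ T, (x u : ℝ) = f T)
      (by simp [hf.empty]) (fun A hA B hB => tight_union hf hx hA hB) fun u _ => hS3 u
  have hTH : ∀ u ∈ T, θ < p u := by
    intro u hu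
    obtain ⟨s, hs', hus⟩ := Finset.mem_sup.1 hu
    exact lt_of_lt_of_le (Finset.mem_filter.1 hs').2 (hS2 s u hus)
  refine (vectorRank_le f _ T).trans (le_of_eq ?_)
  rw [← Finset.sum_add_sum_compl T, ← htight]
  congr 1
  · exact Finset.sum_congr rfl fun u hu => by rw [if_pos (hTH u hu)]
  · refine Finset.sum_congr rfl fun u hu => ?_
    split_ifs with h
    · rcases hS1 u with h' | h'
      · rw [h']
      · exact absurd (Finset.mem_sup.2 ⟨u, by simp [hH, h], h'⟩) (Finset.mem_compl.1 hu)
    · rfl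

end GreedyCertificate

/-! ### Layers of thresholds -/

/-- Integrating over the threshold `θ` turns an inequality for every layer into one for the weighted
sums. -/
theorem sum_mul_nonneg_of_layers {κ : Type*} [Fintype κ] (c p : κ → ℝ) (hp : ∀ k, 0 ≤ p k)
    (h : ∀ θ, 0 ≤ ∑ k, if θ < p k then c k else 0) : 0 ≤ ∑ k, c k * p k := by
  set M := ∑ k, p k
  have hM : ∀ k, p k ≤ M := fun k =>
    Finset.single_le_sum (f := p) (fun k _ => hp k) (Finset.mem_univ k)
  have hind : ∀ k, (fun θ : ℝ => if θ < p k then c k else 0) =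
      (Set.Iio (p k)).indicator fun _ => c k := fun k => by
    ext θ; simp [Set.indicator_apply]
  have hint : ∀ k, MeasureTheory.IntegrableOn (fun θ : ℝ => if θ < p k then c k else 0)
      (Set.Ico 0 M) := fun k => by
    rw [hind]
    exact (MeasureTheory.integrableOn_const (by simp)).indicator measurableSet_Iio
  have h1 : 0 ≤ ∫ θ in Set.Ico 0 M, ∑ k, if θ < p k then c k else 0 :=
    MeasureTheory.integral_nonneg fun θ => h θ
  rw [MeasureTheory.integral_finsetSum _ fun k _ => hint k] at h1
  refine h1.trans (le_of_eq (Finset.sum_congr rfl fun k _ => ?_))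
  rw [hind, MeasureTheory.setIntegral_indicator measurableSet_Iio, Set.Ico_inter_Iio,
    min_eq_right (hM k), MeasureTheory.setIntegral_const]
  simp [hp k, mul_comm]

/-! ### Submodular valuations -/

/-- A monotone submodular valuation with diminishing marginal returns has at every bundle `x` linear
prices that account for the whole value of `x` over the value of nothing, and for at most the value
of any smaller bundle. The price of a good is the average over its units of its marginal value
when the goods are added one by one. -/
theorem exists_supporting_prices {T : Type*} [Fintype T] [DecidableEq T] {v : (T → ℝ≥0) → ℝ≥0}
    (hv : v ∈ submodularValuations T) (x : T → ℝ≥0) :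
    ∃ w : T → ℝ≥0, v x = v 0 + ∑ t, w t * x t ∧
      ∀ y ≤ x, v 0 + ∑ t, w t * y t ≤ v y := by
  obtain ⟨hmono, hsub, hconc⟩ := hv
  suffices key : ∀ s : Finset T, ∃ w : T → ℝ≥0, v (s.piecewise x 0) = v 0 + ∑ t ∈ s, w t * x t ∧
      ∀ y ≤ x, v 0 + ∑ t ∈ s, w t * y t ≤ v (s.piecewise y 0) by
    simpa using key Finset.univ
  intro s
  induction s using Finset.induction_on with
  | empty => exact ⟨0, by simp, by simp⟩
  | insert t s ht ih =>
    obtain ⟨w, hw1, hw2⟩ := ih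
    set m : ℝ≥0 := v ((insert t s).piecewise x 0) - v (s.piecewise x 0) with hm
    have hle : v (s.piecewise x 0) ≤ v ((insert t s).piecewise x 0) := by
      apply hmono
      intro u
      by_cases hu : u ∈ s
      · simp [Finset.piecewise, hu]
      · simp [Finset.piecewise, hu]
    have hmv : v ((insert t s).piecewise x 0) = v (s.piecewise x 0) + m :=
      (add_tsub_cancel_of_le hle).symm
    have hins : (insert t s).piecewise x 0 = Function.update (s.piecewise x 0) t (x t) :=
      Finset.piecewise_insert ..
    have hself : Function.update (s.piecewise x 0) t 0 = s.piecewise x 0 := by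
      rw [Function.update_eq_self_iff]; simp [ht]
    -- For `x t = 0` the quotient is `0`, which is right since then `m = 0`.
    have hmx : m / x t * x t = m := by
      rcases eq_or_ne (x t) 0 with h0 | h0
      · rw [h0] at hins ⊢
        rw [hm, hins, hself]
        simp
      · exact div_mul_cancel₀ _ h0
    have hupd : ∀ z : T → ℝ≥0, ∑ u ∈ insert t s, Function.update w t (m / x t) u * z u =
        m / x t * z t + ∑ u ∈ s, w u * z u := by
      intro z
      rw [Finset.sum_insert ht, Function.update_self]
      congr 1
      refine Finset.sum_congr rfl fun u hu => ?_
      rw [Function.update_of_ne]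
      rintro rfl
      exact ht hu
    refine ⟨Function.update w t (m / x t), ?_, fun y hy => ?_⟩
    · rw [hupd, hmv, hw1, hmx]; ring
    · rw [hupd]
      have hS := hsub ((insert t s).piecewise y 0) (s.piecewise x 0)
      have hsup : (insert t s).piecewise y 0 ⊔ s.piecewise x 0 =
          Function.update (s.piecewise x 0) t (y t) := by
        ext u
        rcases eq_or_ne u t with rfl | hut
        · simp [Finset.piecewise, ht]
        · by_cases hu : u ∈ s
          · simp [Finset.piecewise, hut, hu, hy u]
          · simp [Finset.piecewise, hut, hu]
      have hinf : (insert t s).piecewise y 0 ⊓ s.piecewise x 0 = s.piecewise y 0 := by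
        ext u
        by_cases hu : u ∈ s
        · simp [Finset.piecewise, hu, hy u]
        · simp [Finset.piecewise, hu]
      rw [hsup, hinf] at hS
      have hmarg : v (s.piecewise x 0) + m / x t * y t ≤
          v (Function.update (s.piecewise x 0) t (y t)) := by
        rcases eq_or_ne (x t) 0 with h0 | h0
        · have hy0 : y t = 0 := le_antisymm (h0 ▸ hy t) zero_le
          rw [hy0, hself]; simp
        · have hlam : y t / x t ≤ 1 := div_le_one_of_le₀ (hy t) zero_le
          have hc := (hconc (s.piecewise x 0) t).2 (Set.mem_univ (x t)) (Set.mem_univ 0)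
            (zero_le (a := y t / x t)) (zero_le (a := 1 - y t / x t))
            (add_tsub_cancel_of_le hlam)
          simp only [smul_eq_mul, mul_zero, add_zero, div_mul_cancel₀ _ h0, hself] at hc
          rw [← hins, hmv] at hc
          refine le_trans (le_of_eq ?_) hc
          calc v (s.piecewise x 0) + m / x t * y t
              = (y t / x t + (1 - y t / x t)) * v (s.piecewise x 0) + m / x t * y t := by
                rw [add_tsub_cancel_of_le hlam, one_mul]
            _ = _ := by rw [add_mul, mul_add]; field_simp; ring
      have h2 := hw2 y hy
      rw [← NNReal.coe_le_coe] at *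
      push_cast at *
      linarith

/-! ### Smoothness -/

section Smoothness

variable {ι : Type*} [Fintype ι] [DecidableEq ι] {E : ι → Type*} [∀ i, Fintype (E i)]
  [∀ i, DecidableEq (E i)] {f : Finset (Σ i, E i) → ℝ}

/-- The layer inequality: when every player in turn deviates from `a` to bids `p` with the parts of
a feasible vector `x` as capacities, then the deviators receive in total, on the goods with bid
`p` above `θ`, at least what `x` gives to these goods minus what is allocated at `a` to the goods
with bids above `θ`. -/
theorem layer_le_sum_deviation (hf : IsPolymatroidRank f) (o : GreedyOrder E)
    (a c : ∀ i, BidCap (E i)) (hc : (fun u : Σ i, E i => (c u.1 u.2).2) ∈ polymatroid f) (θ : ℝ) :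
    ∑ u : Σ i, E i, (if θ < (c u.1 u.2).1 then ((c u.1 u.2).2 : ℝ) else 0) -
        ∑ u : Σ i, E i, (if θ < (a u.1 u.2).1 then (greedyAllocation f o a u : ℝ) else 0) ≤
      ∑ u : Σ i, E i, if θ < (c u.1 u.2).1 then
        (greedyAllocation f o (Function.update a u.1 (c u.1)) u : ℝ) else 0 := by
  set A : (Σ i, E i) → ℝ := fun u => if θ < (a u.1 u.2).1 then ((a u.1 u.2).2 : ℝ) else 0 with hA
  set B : (Σ i, E i) → ℝ := fun u => if θ < (c u.1 u.2).1 then ((c u.1 u.2).2 : ℝ) else 0 with hB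
  set Ai : ι → (Σ i, E i) → ℝ := fun i u => if u.1 = i then 0 else A u with hAi
  set Bi : ι → (Σ i, E i) → ℝ := fun i u => if u.1 = i then B u else 0 with hBi
  have hA0 : ∀ u, 0 ≤ A u := fun u => by simp only [hA]; split_ifs <;> simp
  have hB0 : ∀ u, 0 ≤ B u := fun u => by simp only [hB]; split_ifs <;> simp
  have hsumB : ∀ u, ∑ i, Bi i u = B u := fun u => by simp [hBi]
  have hrank := sum_sub_vectorRank_le hf (c := A) (ci := Ai) (b := Bi) hA0
    (fun i u => by simp only [hAi]; split_ifs <;> simp [hA0 u])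
    (fun i u => by simp only [hBi]; split_ifs <;> simp [hB0 u])
    (fun S => by
      simp only [hsumB]
      refine le_trans (Finset.sum_le_sum fun u _ => ?_) (hc S)
      simp only [hB]; split_ifs <;> simp)
  simp only [hsumB] at hrank
  have hgreedy : vectorRank f A ≤
      ∑ u : Σ i, E i, (if θ < (a u.1 u.2).1 then (greedyAllocation f o a u : ℝ) else 0) :=
    vectorRank_le_sum_greedy hf _ (fun u => ((a u.1 u.2).1 : ℝ)) (o.nodup a) (o.mem a)
      (by simpa using o.sorted a) θ
  have hdev : ∀ i, vectorRank f (Ai i + Bi i) - vectorRank f (Ai i) ≤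
      ∑ t, if θ < (c i t).1 then
        (greedyAllocation f o (Function.update a i (c i)) ⟨i, t⟩ : ℝ) else 0 := by
    intro i
    set a' := Function.update a i (c i) with ha'
    set y := greedyAllocation f o a'
    have hcap : Ai i + Bi i =
        fun u => if θ < ((a' u.1 u.2).1 : ℝ) then ((a' u.1 u.2).2 : ℝ) else 0 := by
      ext ⟨j, t⟩
      rcases eq_or_ne j i with rfl | hj
      · simp [hAi, hBi, hB, ha']
      · simp [hAi, hBi, hA, ha', hj]
    have h1 : vectorRank f (Ai i + Bi i) ≤
        ∑ u : Σ i, E i, (if θ < (a' u.1 u.2).1 then (y u : ℝ) else 0) := by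
      rw [hcap]
      exact vectorRank_le_sum_greedy hf _ (fun u => ((a' u.1 u.2).1 : ℝ)) (o.nodup a') (o.mem a')
        (by simpa using o.sorted a') θ
    have hyle : ∀ u, y u ≤ (a' u.1 u.2).2 := fun u => greedy_le_capacity _ _ u
    have hymem : y ∈ polymatroid f := greedy_mem hf _ _
    have h2 : ∑ u : Σ i, E i, (if u.1 = i then 0 else
        if θ < (a' u.1 u.2).1 then (y u : ℝ) else 0) ≤ vectorRank f (Ai i) := by
      refine sum_le_vectorRank (fun S => ?_) fun u => ?_
      · refine le_trans (Finset.sum_le_sum fun u _ => ?_) (hymem S)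
        split_ifs <;> simp
      · have := hyle u
        obtain ⟨j, t⟩ := u
        rcases eq_or_ne j i with rfl | hj
        · simp [hAi]
        · simp only [ha', Function.update_of_ne hj] at this
          simp only [hAi, hA, ha', hj, Function.update_of_ne hj, if_false]
          split_ifs
          · exact_mod_cast this
          · exact le_rfl
    have h3 : ∑ u : Σ i, E i, (if θ < (a' u.1 u.2).1 then (y u : ℝ) else 0) -
        ∑ u : Σ i, E i, (if u.1 = i then 0 else
          if θ < (a' u.1 u.2).1 then (y u : ℝ) else 0) =
        ∑ t, if θ < (c i t).1 then (y ⟨i, t⟩ : ℝ) else 0 := by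
      rw [← Finset.sum_sub_distrib, Fintype.sum_sigma, Finset.sum_eq_single i]
      · simp [ha']
      · intro j _ hj
        simp [hj]
      · simp
    linarith
  have hsum := Finset.sum_le_sum fun i (_ : i ∈ Finset.univ) => hdev i
  rw [Fintype.sum_sigma (fun u : Σ i, E i => if θ < (c u.1 u.2).1 then
    (greedyAllocation f o (Function.update a u.1 (c u.1)) u : ℝ) else 0)]
  linarith

/-- The layer inequality integrated over the thresholds. -/
theorem sum_bid_mul_capacity_le (hf : IsPolymatroidRank f) (o : GreedyOrder E)
    (a c : ∀ i, BidCap (E i)) (hc : (fun u : Σ i, E i => (c u.1 u.2).2) ∈ polymatroid f) :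
    ∑ i, ∑ t, ((c i t).1 : ℝ) * (c i t).2 ≤
      ∑ i, ∑ t, ((a i t).1 : ℝ) * greedyAllocation f o a ⟨i, t⟩ +
      ∑ i, ∑ t, ((c i t).1 : ℝ) * greedyAllocation f o (Function.update a i (c i)) ⟨i, t⟩ := by
  have h := sum_mul_nonneg_of_layers
    (Sum.elim (fun u : Σ i, E i => (greedyAllocation f o (Function.update a u.1 (c u.1)) u : ℝ) -
        (c u.1 u.2).2) fun u : Σ i, E i => (greedyAllocation f o a u : ℝ))
    (Sum.elim (fun u : Σ i, E i => ((c u.1 u.2).1 : ℝ)) fun u => ((a u.1 u.2).1 : ℝ))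
    (by rintro (u | u) <;> simp) fun θ => by
      have hθ := layer_le_sum_deviation hf o a c hc θ
      rw [Fintype.sum_sum_type]
      change 0 ≤ ∑ u : Σ i, E i, (if θ < ((c u.1 u.2).1 : ℝ) then
          (greedyAllocation f o (Function.update a u.1 (c u.1)) u : ℝ) - (c u.1 u.2).2 else 0) +
        ∑ u : Σ i, E i, (if θ < ((a u.1 u.2).1 : ℝ) then (greedyAllocation f o a u : ℝ) else 0)
      have e : ∀ u : Σ i, E i, (if θ < ((c u.1 u.2).1 : ℝ) then
          (greedyAllocation f o (Function.update a u.1 (c u.1)) u : ℝ) - (c u.1 u.2).2 else 0) =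
          (if θ < (c u.1 u.2).1 then
            (greedyAllocation f o (Function.update a u.1 (c u.1)) u : ℝ) else 0) -
          if θ < (c u.1 u.2).1 then ((c u.1 u.2).2 : ℝ) else 0 := fun u => by
        split_ifs <;> simp
      simp only [e, Finset.sum_sub_distrib]
      linarith
  rw [Fintype.sum_sum_type] at h
  simp only [Sum.elim_inl, Sum.elim_inr, sub_mul, Finset.sum_sub_distrib, Fintype.sum_sigma] at h
  simp only [mul_comm ((c _ _).1 : ℝ), mul_comm ((a _ _).1 : ℝ)]
  linarith

theorem hasSum_pure_mul {α : Type*} (c : α) (g : α → ℝ) :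
    HasSum (fun b => (PMF.pure c b).toReal * g b) (g c) := by
  convert hasSum_single (f := fun b => (PMF.pure c b).toReal * g b) c fun b hb => ?_ using 1
  · simp
  · simp [PMF.pure_apply, hb]

theorem utility_update (hf : IsPolymatroidRank f) (o : GreedyOrder E) (a : ∀ i, BidCap (E i))
    (i : ι) (b : BidCap (E i)) (v : (E i → ℝ≥0) → ℝ≥0) :
    (polymatroidMechanism f hf o).utility (Function.update a i b) i v =
      (v fun t => greedyAllocation f o (Function.update a i b) ⟨i, t⟩) -
        ∑ t, ((b t).1 : ℝ) * greedyAllocation f o (Function.update a i b) ⟨i, t⟩ := by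
  simp [Mechanism.utility, polymatroidMechanism]

end Smoothness

theorem corollary3p6 {ι : Type*} [Fintype ι] [DecidableEq ι] {E : ι → Type*}
    [∀ i, Fintype (E i)] [∀ i, DecidableEq (E i)]
    (f : Finset (Σ i, E i) → ℝ) (hf : IsPolymatroidRank f) (o : GreedyOrder E) :
    (polymatroidMechanism f hf o).IsSmooth (fun i => submodularValuations (E i)) (1 / 3) 1 := by
  refine ⟨by norm_num, by norm_num, fun v hv x hx => ?_⟩
  choose w hwx hwy using fun i => exists_supporting_prices (hv i) (x i)
  set c : ∀ i, BidCap (E i) := fun i t => (w i t / 2, x i t) with hc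
  refine ⟨fun i => PMF.pure (c i), fun a => ⟨fun i => (hasSum_pure_mul _ _).summable, ?_⟩⟩
  have hmain := sum_bid_mul_capacity_le hf o a c hx.1
  have hutil : ∀ i, (v i 0 : ℝ) + ∑ t, ((c i t).1 : ℝ) *
      greedyAllocation f o (Function.update a i (c i)) ⟨i, t⟩ ≤
      (polymatroidMechanism f hf o).utility (Function.update a i (c i)) i (v i) := by
    intro i
    -- Half of `∑ t, w i t * y t` is paid, since the bids are `w i t / 2`.
    set y : E i → ℝ≥0 := fun t => greedyAllocation f o (Function.update a i (c i)) ⟨i, t⟩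
    have hyx : y ≤ x i := fun t => by
      refine (greedy_le_capacity _ _ _).trans (le_of_eq ?_)
      exact congrArg Prod.snd (congrFun (Function.update_self i (c i) a) t)
    have h1 := NNReal.coe_le_coe.2 (hwy i y hyx)
    have h2 : (polymatroidMechanism f hf o).utility (Function.update a i (c i)) i (v i) =
        (v i y : ℝ) - ∑ t, ((c i t).1 : ℝ) * y t :=
      utility_update hf o a i (c i) (v i)
    have h3 : ∑ t, (w i t : ℝ) * y t = 2 * ∑ t, ((c i t).1 : ℝ) * y t := by
      rw [Finset.mul_sum]
      refine Finset.sum_congr rfl fun t _ => ?_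
      simp only [hc]; push_cast; ring
    push_cast at h1
    rw [h2]
    change _ + ∑ t, ((c i t).1 : ℝ) * y t ≤ _
    linarith
  have hwel : Mechanism.welfare v x =
      ∑ i, (v i 0 : ℝ) + 2 * ∑ i, ∑ t, ((c i t).1 : ℝ) * (c i t).2 := by
    rw [Mechanism.welfare, Finset.mul_sum, ← Finset.sum_add_distrib]
    refine Finset.sum_congr rfl fun i _ => ?_
    rw [hwx i, Finset.mul_sum]
    push_cast
    congr 1
    refine Finset.sum_congr rfl fun t _ => ?_
    simp only [hc]; push_cast; ring
  have hrev : (polymatroidMechanism f hf o).revenue a =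
      ∑ i, ∑ t, ((a i t).1 : ℝ) * greedyAllocation f o a ⟨i, t⟩ := by
    simp [Mechanism.revenue, polymatroidMechanism]
  have hsum := Finset.sum_le_sum fun i (_ : i ∈ Finset.univ) => hutil i
  rw [Finset.sum_add_distrib] at hsum
  have h0 : 0 ≤ ∑ i, (v i 0 : ℝ) := Finset.sum_nonneg fun i _ => NNReal.coe_nonneg _
  have h0' : 0 ≤ ∑ i, ∑ t, ((c i t).1 : ℝ) * (c i t).2 :=
    Finset.sum_nonneg fun i _ => Finset.sum_nonneg fun t _ => by positivity
  have hexp : ∀ i, expectation (PMF.pure (c i)) (fun b =>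
      (polymatroidMechanism f hf o).utility (Function.update a i b) i (v i)) =
      (polymatroidMechanism f hf o).utility (Function.update a i (c i)) i (v i) :=
    fun i => (hasSum_pure_mul _ _).tsum_eq
  rw [hwel, hrev]
  refine le_trans ?_ (Finset.sum_le_sum fun i _ => (hexp i).ge)
  linarith
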